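/- Let $p$ be a prime number, $K$ a totally real number field, $L/K$ a Galois extension of $p$-power degree with $L$ totally real, and $\Sigma=\mathrm{Gal}(L/K)$. Let $S$ be a finite set of finite primes of $K$ containing all primes above $p$ and all primes that ramify in $L$. For an intermediate field $K\subseteq F\subseteq L$ put $\Sigma_F=\mathrm{Gal}(L/F)$. Let $L_S$ be the maximal abelian extension of $L$ that is unramified at all finite primes not above $S$, and $H_S=\mathrm{Gal}(L_S/L)$. The group $\Sigma$ acts on $H_S$ by $h\mapsto s h s^{-1}$, where $s\in\mathrm{Gal}(L_S/K)$ is any extension of $\sigma\in\Sigma$; let $\mathrm{Stab}_\Sigma(\varepsilon)$ be the stabilizer in $\Sigma$ of a function $\varepsilon$ on $H_S$ for the induced action. For an integral ideal $\mathfrak b$ of $L$ prime to $S$ write $\varepsilon(\mathfrak b)$ for the value of $\varepsilon$ at the Artin symbol $(\mathfrak b,L_S/L)\in H_S$. A locally constant function $\varepsilon$ on $H_S$ is called even if $\varepsilon(ch)=\varepsilon(h)$ for all $h\in H_S$ and all $c\in H_S$ that are restrictions of complex conjugation with respect to an embedding $L_S\hookrightarrow\mathbb C$. The M\"obius function $\mu_G$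 of the subgroups of a finite group $G$ is given by $\mu_G(1)=1$ and $\mu_G(G')=-\sum_{1\le G''<G'}\mu_G(G'')$ for $1\ne G'\le G$. Let $\mathbb Z_{(p)}\subset\mathbb Q$ be the localization of $\mathbb Z$ at $p\mathbb Z$. Fix a totally positive $\alpha\in\mathfrak o_K$. For $K\subseteq F\subseteq L$ let $[\alpha]_F$ be the set of pairs $(\alpha_F,\mathfrak a_F)$ with $0\ll\alpha_F\in\mathfrak a_F\subseteq\mathfrak o_F$, $\mathfrak a_F$ an ideal prime to $S$, and $\mathrm{Tr}_{F/K}(\alpha_F)=[F:K]\alpha$. Then: (1) For every $F$ the set $[\alpha]_F$ is finite, and $(\alpha_F,\mathfrak a_F)\mapsto(\alpha_F,\mathfrak a_F\mathfrak o_L)$ is a bijection from $[\alpha]_F$ onto the set of elements of $[\alpha]_L$ that are fixed by $\Sigma_F$ under $(\beta,\mathfrak b)\mapsto(\sigma\beta,\sigma\mathfrak b)$. (2) For every even positive integer $k$ and every even locally constant function $\varepsilon:H_S\to\mathbb Z_{(p)}$, $$\sum_{K\subseteq F\subseteq L}\mu_\Sigma(\Sigma_F)\sum_{(\alpha_F,\mathfrak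 a_F)\in[\alpha]_F}\varepsilon(\mathfrak a_F\mathfrak o_L)\,N_F(\mathfrak a_F)^{[L:F]k-1}\equiv 0 \mod |\mathrm{Stab}_\Sigma(\varepsilon)|\,\mathbb Z_{(p)},$$ where $N_F$ denotes the absolute norm. (3) For every finite $p$-group $P$ and every unit $r$ of $\mathbb Z_{(p)}$, $$\sum_{1\le P'\le P}\mu_P(P')\,r^{[P:P']}\equiv 0 \mod |P|\,\mathbb Z_{(p)}.$$ -/

import Mathlib

open NumberField IsDedekindDomain
open scoped Pointwise

noncomputable section

/-- The Möbius function `μ_G(H) = μ(1, H)` of the poset of subgroups of a finite group `G`. -/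
def subgroupMobius (G : Type*) [Group G] [Finite G] (H : Subgroup G) : ℤ := by
  classical
  letI : Fintype (Subgroup G) := Fintype.ofFinite _
  letI : LocallyFiniteOrder (Subgroup G) := Fintype.toLocallyFiniteOrder
  exact IncidenceAlgebra.mu ℤ ⊥ H

/-- The localization `ℤ_(p)` of `ℤ` at the prime ideal generated by `p`. -/
abbrev ZLoc (p : ℕ) [Fact p.Prime] : Type :=
  Localization.AtPrime (Ideal.span {(p : ℤ)})

/-- For `K ⊆ F ⊆ E` and a set `S` of finite primes of `K`: the extension `E / F` is unramified at
all finite primes of `E` that do not lie above a prime in `S`. -/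
def IsUnramifiedOutside (K F E : Type*) [Field K] [Field F] [Field E]
    [Algebra K E] [Algebra F E] (S : Finset (HeightOneSpectrum (𝓞 K))) : Prop :=
  ∀ Q : HeightOneSpectrum (𝓞 E), (∀ v ∈ S, ¬ Q.asIdeal.LiesOver v.asIdeal) →
    Algebra.IsUnramifiedAt (𝓞 F) Q.asIdeal

/-- The finite abelian extensions of `L`, inside an algebraic closure of `L`, that are unramified
outside the finite primes above `S` (no condition at the archimedean primes). -/
def finiteAbelianUnramified (K L : Type*) [Field K] [Field L] [Algebra K L]
    (S : Finset (HeightOneSpectrum (𝓞 K))) : Set (IntermediateField L (AlgebraicClosure L)) :=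
  {E | FiniteDimensional L E ∧ IsAbelianGalois L E ∧ IsUnramifiedOutside K L E S}

/-- `L_S`: the maximal abelian extension of `L` unramified outside the finite primes above `S`. -/
def maxAbelian (K L : Type*) [Field K] [Field L] [Algebra K L]
    (S : Finset (HeightOneSpectrum (𝓞 K))) : IntermediateField L (AlgebraicClosure L) :=
  sSup (finiteAbelianUnramified K L S)

/-- The group `H_S = Gal(L_S / L)`; as a Galois group it carries the Krull topology. -/
abbrev HS (K L : Type*) [Field K] [Field L] [Algebra K L]
    (S : Finset (HeightOneSpectrum (𝓞 K))) : Type _ :=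
  Gal(maxAbelian K L S / L)

theorem HS_mul_comm (K L : Type*) [Field K] [Field L] [Algebra K L]
    (S : Finset (HeightOneSpectrum (𝓞 K))) (σ τ : HS K L S) : σ * τ = τ * σ := by
  let M := maxAbelian K L S
  let c : HS K L S := σ * τ * σ⁻¹ * τ⁻¹
  let T : IntermediateField L M := IntermediateField.fixedField (Subgroup.zpowers c)
  have key : M ≤ IntermediateField.lift T := by
    refine sSup_le ?_
    intro E hE
    have hEM : E ≤ M := le_sSup hE
    obtain ⟨_, hab, _⟩ := hE
    let E' : IntermediateField L M := IntermediateField.restrict hEM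
    have : IsAbelianGalois L E' :=
      .of_algHom (IntermediateField.restrictAlgEquiv hEM).symm.toAlgHom
    intro y hy
    rw [IntermediateField.mem_lift ⟨y, hEM hy⟩]
    have h1 : AlgEquiv.restrictNormalHom E' c = 1 := by
      rw [show c = σ * τ * σ⁻¹ * τ⁻¹ from rfl, map_mul, map_mul, map_mul, map_inv, map_inv,
        this.is_comm.comm (AlgEquiv.restrictNormalHom E' σ), mul_inv_cancel_right, mul_inv_cancel]
    have hy' : (⟨y, hEM hy⟩ : M) ∈ E' := (IntermediateField.mem_restrict hEM _).2 hy
    have h2 : c (⟨y, hEM hy⟩ : M) = ⟨y, hEM hy⟩ := by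
      have := AlgEquiv.restrictNormal_commutes c E' ⟨_, hy'⟩
      rw [show AlgEquiv.restrictNormal c E' = 1 from h1] at this
      exact this.symm
    rintro ⟨g, hg⟩
    have hle : Subgroup.zpowers c ≤
        MulAction.stabilizer (HS K L S) (⟨y, hEM hy⟩ : M) := by
      rw [Subgroup.zpowers_le]
      exact h2
    exact hle hg
  have h : c = 1 := by
    ext x : 1
    have hx : x ∈ T := (IntermediateField.mem_lift x).1 (key x.2)
    exact hx ⟨_, Subgroup.mem_zpowers _⟩
  exact mul_inv_eq_iff_eq_mul.1 (mul_inv_eq_one.1 h)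

instance HS.instCommGroup (K L : Type*) [Field K] [Field L] [Algebra K L]
    (S : Finset (HeightOneSpectrum (𝓞 K))) : CommGroup (HS K L S) where
  mul_comm := HS_mul_comm K L S

/-- `h ∈ H_S` is a Frobenius automorphism at the prime `q` of `L`: one has `h x ≡ x ^ N(q) mod Q`
for all integers `x` of `L_S` and all primes `Q` of `L_S` above `q`. -/
def IsFrobeniusAt (K L : Type*) [Field K] [Field L] [Algebra K L]
    (S : Finset (HeightOneSpectrum (𝓞 K))) (q : Ideal (𝓞 L)) (h : HS K L S) : Prop :=
  ∀ Q : Ideal (𝓞 (maxAbelian K L S)), Q.IsPrime → Q.LiesOver q →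
    AlgHom.IsArithFrobAt (RingOfIntegers.mapAlgHom (k := L) h) Q

open Classical in
/-- The Frobenius automorphism in `H_S` at a prime `q` of `L` that is not above `S`, where it
exists and is unique. -/
def frobeniusAt (K L : Type*) [Field K] [Field L] [Algebra K L]
    (S : Finset (HeightOneSpectrum (𝓞 K))) (q : Ideal (𝓞 L)) : HS K L S :=
  if h : ∃ g, IsFrobeniusAt K L S q g then h.choose else 1

/-- The Artin symbol `(b, L_S / L) ∈ H_S` of an integral ideal `b` of `L` prime to `S`: the product
of the Frobenius automorphisms at the prime factors of `b`, counted with multiplicity. -/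
def artinSymbol (K L : Type*) [Field K] [Field L] [NumberField L] [Algebra K L]
    (S : Finset (HeightOneSpectrum (𝓞 K))) (b : Ideal (𝓞 L)) : HS K L S :=
  ((UniqueFactorizationMonoid.normalizedFactors b).map (frobeniusAt K L S)).prod

/-- A function `ε` on `H_S` is even if `ε (c h) = ε h` for all `h ∈ H_S` and all `c ∈ H_S` that are
the restriction of complex conjugation under some embedding of `L_S` into `ℂ`. -/
def IsEvenFunction {K L A : Type*} [Field K] [Field L] [Algebra K L]
    {S : Finset (HeightOneSpectrum (𝓞 K))} (ε : HS K L S → A) : Prop :=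
  ∀ (φ : maxAbelian K L S →+* ℂ) (c : HS K L S), ComplexEmbedding.IsConj φ c →
    ∀ h, ε (c * h) = ε h

/-- The element `s h s⁻¹` of `Gal(M / L)` for `s ∈ Gal(M / K)` and `h ∈ Gal(M / L)`, where
`L / K` is normal. -/
def conjGal {K L M : Type*} [Field K] [Field L] [Field M] [Algebra K L] [Algebra K M]
    [Algebra L M] [IsScalarTower K L M] [Normal K L] (s : Gal(M/K)) (h : Gal(M/L)) : Gal(M/L) :=
  { (s * h.restrictScalars K * s⁻¹).toRingEquiv with
    commutes' := fun x => by
      have h1 : s⁻¹ (algebraMap L M x) = algebraMap L M (s⁻¹.restrictNormal L x) :=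
        (AlgEquiv.restrictNormal_commutes s⁻¹ L x).symm
      change s (h (s⁻¹ (algebraMap L M x))) = algebraMap L M x
      rw [h1, AlgEquiv.commutes, ← h1]
      exact s.apply_symm_apply _ }

/-- The stabilizer in `Gal(L / K)` of a function `ε` on `H_S = Gal(L_S / L)`. An element `σ` of
`Gal(L / K)` acts on `H_S` by `h ↦ s h s⁻¹` for any extension `s ∈ Gal(L_S / K)` of `σ`. -/
def stabilizerFun {K L A : Type*} [Field K] [Field L] [Algebra K L] [Normal K L]
    {S : Finset (HeightOneSpectrum (𝓞 K))} (ε : HS K L S → A) : Subgroup Gal(L/K) :=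
  Subgroup.map (AlgEquiv.restrictNormalHom L)
    { carrier := {s : Gal(maxAbelian K L S/K) | ∀ h, ε (conjGal s h) = ε h}
      one_mem' := fun h => rfl
      mul_mem' := fun {s t} hs ht h => (hs (conjGal t h)).trans (ht h)
      inv_mem' := fun {s} hs h => by
        have : conjGal s (conjGal s⁻¹ h) = h := by
          ext x : 1
          change s (s⁻¹ (h (s⁻¹⁻¹ (s⁻¹ x)))) = h x
          rw [inv_inv, show s (s⁻¹ x) = x from s.apply_symm_apply x]
          exact s.apply_symm_apply _
        rw [← hs (conjGal s⁻¹ h), this] }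

/-- `β ≫ 0` for an integer `β` of a totally real field `F`. -/
def IsTotallyPositive {F : Type*} [Field F] (β : 𝓞 F) : Prop :=
  ∀ φ : F →+* ℝ, 0 < φ β

/-- The integral ideal `a` of `F` is prime to the set `S` of primes of the subfield `K`. -/
def IsPrimeTo {K F : Type*} [Field K] [Field F] [Algebra K F]
    (S : Finset (HeightOneSpectrum (𝓞 K))) (a : Ideal (𝓞 F)) : Prop :=
  ∀ v ∈ S, IsCoprime a (v.asIdeal.map (algebraMap (𝓞 K) (𝓞 F)))

/-- The set `[α]_F` of pairs `(β, a)` with `0 ≪ β ∈ a ⊆ 𝓞 F`, the ideal `a` prime to `S` and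
`Tr_{F/K} β = [F : K] α`. -/
def traceSet {K : Type*} [Field K] (S : Finset (HeightOneSpectrum (𝓞 K))) (α : 𝓞 K)
    (F : Type*) [Field F] [Algebra K F] : Set (𝓞 F × Ideal (𝓞 F)) :=
  {x | IsTotallyPositive x.1 ∧ x.1 ∈ x.2 ∧ IsPrimeTo S x.2 ∧
    Algebra.trace K F (x.1 : F) = (Module.finrank K F : K) * (α : K)}

end

/-! The `p`-group congruence counts free orbits. The functions `P → Fin n` fixed by `H` number `n ^
[P : H]`, so Möbius inversion turns `∑ μ(H) n ^ [P : H]` into the number of functions with trivial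
stabilizer. `P` permutes these freely, hence `|P|` divides that number. Since `|P| = p ^ m`,
approximating `r ∈ ℤ_(p)` by a natural number modulo `p ^ m` gives the general case.

For the main congruence, `bijOn_traceSet` moves every inner sum to `[α]_L`. After exchanging the
sums, `y = (β, b)` contributes `ε(b) w(y)`, where `w(y)` runs over the `F` with `Σ_F ≤ T = Stab(y)`.
The ideal `b` descends to the fixed field of `T`, so `N(b) = n ^ |T|`, and the descent of `b` to `F`
has norm `n ^ [T : Σ_F]`. The exponent `[L : F] k - 1` is such that `w(y) = N(b) ^ k ∑ μ_T(H) (n⁻¹)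
^ [T : H]`, a multiple of `|T|` by the `p`-group congruence; `n` is a unit because `b` is prime to
`p`. Equivariance of the Artin symbol makes `ε(b) w(y)` constant on orbits of `Stab(ε)`, and
orbit-stabilizer supplies the remaining factor. -/

/-! ### Orbit sums and the Möbius function of subgroups -/

/-- An orbit contributes its length times a common value divisible by the stabilizer order; the
product of length and stabilizer order is `|A|`. -/
theorem natCard_dvd_sum_of_stabilizer {A Y R : Type*} [Group A] [Finite A] [Fintype Y]
    [MulAction A Y] [CommRing R] (f : Y → R) (hf : ∀ (a : A) (y : Y), f (a • y) = f y)
    (hd : ∀ y, (Nat.card (MulAction.stabilizer A y) : R) ∣ f y) :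
    (Nat.card A : R) ∣ ∑ y, f y := by
  classical
  rw [← Finset.sum_fiberwise (s := Finset.univ)
    (g := fun y => (Quotient.mk'' y : MulAction.orbitRel.Quotient A Y)) (f := f)]
  refine Finset.dvd_sum fun ω _ => ?_
  induction ω using Quotient.inductionOn' with | _ y =>
  have hfil : (Finset.univ.filter fun z : Y =>
      (Quotient.mk'' z : MulAction.orbitRel.Quotient A Y) = Quotient.mk'' y) =
      (MulAction.orbit A y).toFinset := by
    ext z
    simp [Quotient.eq'', MulAction.orbitRel_apply]
  rw [hfil, Finset.sum_congr rfl (g := fun _ => f y), Finset.sum_const, nsmul_eq_mul,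
    Set.toFinset_card, ← Nat.card_eq_fintype_card]
  · obtain ⟨c, hc⟩ := hd y
    refine ⟨c, ?_⟩
    have := Nat.card_congr (MulAction.orbitEquivQuotientStabilizer A y)
    rw [hc, this, ← mul_assoc, ← Nat.cast_mul, ← Subgroup.card_eq_card_quotient_mul_card_subgroup]
  · intro z hz
    rw [Set.mem_toFinset] at hz
    obtain ⟨a, rfl⟩ := hz
    exact hf a y

theorem sum_subgroupMobius_Iic {G : Type*} [Group G] [Finite G] [Fintype (Subgroup G)]
    [DecidableEq (Subgroup G)] [DecidableLE (Subgroup G)] (H : Subgroup G) :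
    ∑ T ∈ Finset.univ.filter (· ≤ H), subgroupMobius G T = if H = ⊥ then 1 else 0 := by
  classical
  let : LocallyFiniteOrder (Subgroup G) :=
    @Fintype.toLocallyFiniteOrder _ _ (Fintype.ofFinite _) _ _
  have h := IncidenceAlgebra.sum_Icc_mu_right (𝕜 := ℤ) (⊥ : Subgroup G) H
  rw [show (if H = ⊥ then (1 : ℤ) else 0) = if (⊥ : Subgroup G) = H then 1 else 0 by
    simp [eq_comm], ← h]
  refine Finset.sum_congr (by ext; simp) fun T _ => ?_
  unfold subgroupMobius
  convert rfl

/-- The value `μ(1, H)` depends only on the interval below `H`, and every subgroup of the image of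
`H` comes from `T`. -/
theorem subgroupMobius_map {T G : Type*} [Group T] [Finite T] [Group G] [Finite G] (i : T →* G)
    (hi : Function.Injective i) (H : Subgroup T) :
    subgroupMobius G (H.map i) = subgroupMobius T H := by
  classical
  let : Fintype (Subgroup T) := Fintype.ofFinite _
  let : Fintype (Subgroup G) := Fintype.ofFinite _
  induction H using WellFoundedLT.induction with | ind H ih =>
  have h1 := sum_subgroupMobius_Iic H
  have h2 := sum_subgroupMobius_Iic (H.map i)
  have h3 : (Finset.univ.filter (· ≤ H.map i)) =
      (Finset.univ.filter (· ≤ H)).map ⟨Subgroup.map i, Subgroup.map_injective hi⟩ := by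
    ext U
    simp only [Finset.mem_filter, Finset.mem_univ, true_and, Finset.mem_map,
      Function.Embedding.coeFn_mk]
    refine ⟨fun hU => ⟨U.comap i, ?_, ?_⟩, ?_⟩
    · rw [← Subgroup.comap_map_eq_self_of_injective hi H]
      exact Subgroup.comap_mono hU
    · exact Subgroup.map_comap_eq_self (hU.trans (Subgroup.map_le_range i H))
    · rintro ⟨V, hV, rfl⟩
      exact Subgroup.map_mono hV
  rw [h3, Finset.sum_map, Subgroup.map_eq_bot_iff_of_injective H hi, ← h1] at h2
  -- Both recursions have equal sums, and by induction equal terms strictly below `H`; hence the top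
  -- terms agree.
  have hH : H ∈ Finset.univ.filter (· ≤ H) := by simp
  rw [← Finset.add_sum_erase _ _ hH, ← Finset.add_sum_erase _ _ hH,
    Finset.sum_congr rfl (g := fun V => subgroupMobius T V)] at h2
  · exact add_right_cancel h2
  · intro V hV
    simp only [Finset.mem_erase, Finset.mem_filter, Finset.mem_univ, true_and] at hV
    exact ih V (lt_of_le_of_ne hV.2 hV.1)

/-! ### The congruence for finite `p`-groups -/

section Counting
attribute [local instance] arrowAction

theorem mem_stabilizer_arrow_iff {P B : Type*} [Group P] (f : P → B) (H : Subgroup P) :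
    H ≤ MulAction.stabilizer P f ↔ ∀ h ∈ H, ∀ x, f (h * x) = f x := by
  refine ⟨fun hH h hh x => ?_, fun hH h hh => funext fun x => ?_⟩
  · have := congr_fun (hH (H.inv_mem hh) : h⁻¹ • f = f) x
    have h1 : f (h⁻¹⁻¹ * x) = f x := this
    rwa [inv_inv] at h1
  · exact hH h⁻¹ (H.inv_mem hh) x

/-- A function fixed by `H` is the same as a function on the right cosets `H x`. -/
theorem natCard_le_stabilizer_arrow {P : Type*} [Group P] [Finite P] (n : ℕ) (H : Subgroup P) :
    Nat.card {f : P → Fin n // H ≤ MulAction.stabilizer P f} = n ^ H.index := by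
  let e : {f : P → Fin n // H ≤ MulAction.stabilizer P f} ≃
      (Quotient (QuotientGroup.rightRel H) → Fin n) :=
    { toFun := fun f => Quotient.lift f.1 fun a b hab => by
        obtain ⟨h, rfl⟩ := hab
        exact (mem_stabilizer_arrow_iff _ _).1 f.2 h h.2 b
      invFun := fun g => ⟨fun x => g ⟦x⟧, (mem_stabilizer_arrow_iff _ _).2 fun h hh x =>
        congrArg g (Quotient.sound ⟨⟨h, hh⟩, rfl⟩)⟩
      left_inv := fun f => rfl
      right_inv := fun g => funext fun q => by
        induction q using Quotient.inductionOn; rfl }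
  rw [Nat.card_congr e, Nat.card_fun, Nat.card_fin, 
    Nat.card_congr (QuotientGroup.quotientRightRelEquivQuotientLeftRel H), Subgroup.index]

theorem natCard_dvd_sum_subgroupMobius_mul_pow (P : Type*) [Group P] [Finite P]
    [Fintype (Subgroup P)] (n : ℕ) :
    (Nat.card P : ℤ) ∣ ∑ H : Subgroup P, subgroupMobius P H * (n : ℤ) ^ H.index := by
  classical
  let : Fintype P := Fintype.ofFinite _
  -- Expanding the power as a count of functions and exchanging sums leaves, for each `f`, the
  -- Möbius sum over subgroups of its stabilizer, which detects triviality.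
  have key : ∑ H : Subgroup P, subgroupMobius P H * (n : ℤ) ^ H.index =
      ∑ f : P → Fin n, if MulAction.stabilizer P f = ⊥ then (1 : ℤ) else 0 := by
    calc _ = ∑ H : Subgroup P, ∑ f : P → Fin n,
          if H ≤ MulAction.stabilizer P f then subgroupMobius P H else 0 := by
          refine Finset.sum_congr rfl fun H _ => ?_
          rw [← Nat.cast_pow, ← natCard_le_stabilizer_arrow, Nat.card_eq_fintype_card,
            Fintype.card_subtype, ← Finset.sum_filter, Finset.sum_const, nsmul_eq_mul, mul_comm]
      _ = _ := by
          rw [Finset.sum_comm]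
          refine Finset.sum_congr rfl fun f _ => ?_
          rw [← Finset.sum_filter, sum_subgroupMobius_Iic]
  rw [key]
  refine natCard_dvd_sum_of_stabilizer (A := P) _ (fun a f => ?_) fun f => ?_
  · congr 1
    rw [MulAction.stabilizer_smul_eq_stabilizer_map_conj, Subgroup.map_eq_bot_iff_of_injective _
      (MulEquiv.injective _)]
  · split_ifs with h
    · simp [h]
    · exact dvd_zero _

end Counting

theorem exists_natCast_dvd_sub {p : ℕ} [Fact p.Prime] (m : ℕ) (r : ZLoc p) :
    ∃ n : ℕ, ((p : ZLoc p) ^ m) ∣ r - n := by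
  have hp := (Fact.out : p.Prime)
  obtain ⟨a, s, rfl⟩ := IsLocalization.exists_mk'_eq (Ideal.span {(p : ℤ)}).primeCompl r
  have hs : ¬ (p : ℤ) ∣ s := fun h => s.2 (Ideal.mem_span_singleton.2 h)
  have hcop : IsCoprime ((p : ℤ) ^ m) (s : ℤ) :=
    (((Nat.prime_iff_prime_int.1 hp).coprime_iff_not_dvd).2 hs).pow_left
  obtain ⟨u, v, huv⟩ := hcop
  have hpm : (0 : ℤ) < (p : ℤ) ^ m := by have := hp.pos; positivity
  -- Here `r = a / s`, and `v` inverts `s` modulo `p ^ m`.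
  refine ⟨((a * v) % (p : ℤ) ^ m).toNat, ?_⟩
  obtain ⟨w, hw⟩ : (p : ℤ) ^ m ∣ a - (a * v) % (p : ℤ) ^ m * s := by
    refine ⟨a * u + (a * v) / (p : ℤ) ^ m * s, ?_⟩
    have := Int.emod_add_mul_ediv (a * v) ((p : ℤ) ^ m)
    linear_combination (-a) * huv + (-(s : ℤ)) * this
  refine ⟨IsLocalization.mk' _ w s, ?_⟩
  have hcast : ((((a * v) % (p : ℤ) ^ m).toNat : ℕ) : ZLoc p) =
      algebraMap ℤ (ZLoc p) ((a * v) % (p : ℤ) ^ m) := by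
    have : ((((a * v) % (p : ℤ) ^ m).toNat : ℕ) : ℤ) = (a * v) % (p : ℤ) ^ m :=
      Int.toNat_of_nonneg (Int.emod_nonneg _ hpm.ne')
    rw [← this, eq_intCast, Int.cast_natCast, this]
  have hu := IsLocalization.map_units (ZLoc p) s
  rw [← hu.mul_left_inj, hcast, sub_mul, mul_assoc, IsLocalization.mk'_spec,
    IsLocalization.mk'_spec, ← map_mul, ← map_sub, hw]
  simp

theorem natCard_dvd_sum_subgroupMobius_mul_pow_zLoc {p : ℕ} [Fact p.Prime] (P : Type*) [Group P]
    [Finite P] [Fintype (Subgroup P)] (hP : IsPGroup p P) (r : ZLoc p) :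
    (Nat.card P : ZLoc p) ∣ ∑ H : Subgroup P, (subgroupMobius P H : ZLoc p) * r ^ H.index := by
  obtain ⟨m, hm⟩ := IsPGroup.iff_card.1 hP
  obtain ⟨n, hn⟩ := exists_natCast_dvd_sub m r
  have h := map_dvd (Int.castRingHom (ZLoc p)) (natCard_dvd_sum_subgroupMobius_mul_pow P n)
  simp only [eq_intCast, Int.cast_sum, Int.cast_mul, Int.cast_pow, Int.cast_natCast] at h
  rw [← dvd_sub_left h, ← Finset.sum_sub_distrib]
  refine Finset.dvd_sum fun H _ => ?_
  rw [← mul_sub, hm, Nat.cast_pow]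
  exact (hn.trans (sub_dvd_pow_sub_pow r n _)).mul_left _

/-! ### Descent of Galois-stable ideals -/

section Descent

open UniqueFactorizationMonoid

theorem Ideal.smul_map_algebraMap {A B G : Type*} [CommRing A] [CommRing B] [Algebra A B] [Group G]
    [MulSemiringAction G B] [SMulCommClass G A B] (g : G) (a : Ideal A) :
    g • a.map (algebraMap A B) = a.map (algebraMap A B) := by
  rw [Ideal.pointwise_smul_def, Ideal.map_map]
  congr 1
  ext x
  simp

/-- The primes over `P ∩ A` are the conjugates of `P`, so all of them divide the stable ideal `b`.
Each occurs only once in the extension of `P ∩ A`, by unramifiedness, so that extension divides `b`.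
-/
theorem le_map_under_of_smul_eq {A B G : Type*} [CommRing A] [CommRing B]
    [IsDedekindDomain A]
    [IsDedekindDomain B] [Algebra A B] [Module.Finite A B] [Module.IsTorsionFree A B] [Group G]
    [Finite G] [MulSemiringAction G B] [IsGaloisGroup G A B] {b : Ideal B} (hb : b ≠ ⊥)
    (hG : ∀ g : G, g • b = b)
    (hunr : ∀ (P : Ideal B) [P.IsPrime], P ≠ ⊥ → b ≤ P → Algebra.IsUnramifiedAt A P)
    {P : Ideal B} [P.IsPrime] (hP : P ≠ ⊥) (hbP : b ≤ P) :
    b ≤ (P.under A).map (algebraMap A B) := by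
  classical
  set q := P.under A with hq
  have hq0 : q ≠ ⊥ := fun h => hP (Ideal.eq_bot_of_comap_eq_bot h)
  have hm0 : q.map (algebraMap A B) ≠ ⊥ := by
    rwa [Ne, Ideal.map_eq_bot_iff_of_injective (FaithfulSMul.algebraMap_injective A B)]
  rw [← Ideal.dvd_iff_le, dvd_iff_normalizedFactors_le_normalizedFactors hm0 hb,
    Multiset.le_iff_count]
  intro Q
  by_cases hQ : Q ∈ normalizedFactors (q.map (algebraMap A B))
  swap
  · rw [Multiset.count_eq_zero_of_notMem hQ]
    exact Nat.zero_le _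
  have hQprime : Prime Q := prime_of_normalized_factor Q hQ
  have : Q.IsPrime := Ideal.isPrime_of_prime hQprime
  have hQ0 : Q ≠ ⊥ := hQprime.ne_zero
  have hle : q.map (algebraMap A B) ≤ Q := Ideal.le_of_dvd (dvd_of_mem_normalizedFactors hQ)
  have hqmax : q.IsMaximal := Ring.DimensionLEOne.maximalOfPrime hq0 inferInstance
  have hover : Q.LiesOver q :=
    ⟨hqmax.eq_of_le (Ideal.IsPrime.under A Q).ne_top (Ideal.map_le_iff_le_comap.1 hle)⟩
  obtain ⟨g, hg⟩ := Ideal.exists_smul_eq_of_isGaloisGroup q P Q G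
  have hbQ : b ≤ Q := by
    rw [← hg, ← hG g]
    exact (Ideal.pointwise_smul_le_pointwise_smul_iff).2 hbP
  have := hunr Q hQ0 hbQ
  -- The multiplicity of `Q` in the extended ideal is its ramification index, here 1.
  rw [← Ideal.IsDedekindDomain.ramificationIdx'_eq_normalizedFactors_count hm0 inferInstance hQ0,
    Ideal.ramificationIdx'_eq_ramificationIdx q Q hq0, Ideal.ramificationIdx_eq_one,
    Multiset.one_le_count_iff_mem, mem_normalizedFactors_iff hb]
  exact ⟨hQprime, Ideal.dvd_iff_le.2 hbQ⟩

/-- Noetherian induction: dividing `b` by the extension of `P ∩ A` leaves a strictly larger ideal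
that is again stable. -/
theorem Ideal.exists_map_eq_of_smul_eq {A B G : Type*} [CommRing A] [CommRing B]
    [IsDedekindDomain A]
    [IsDedekindDomain B] [Algebra A B] [Module.Finite A B] [Module.IsTorsionFree A B] [Group G]
    [Finite G] [MulSemiringAction G B] [IsGaloisGroup G A B] {b : Ideal B} (hb : b ≠ ⊥)
    (hG : ∀ g : G, g • b = b)
    (hunr : ∀ (P : Ideal B) [P.IsPrime], P ≠ ⊥ → b ≤ P → Algebra.IsUnramifiedAt A P) :
    ∃ a : Ideal A, a.map (algebraMap A B) = b := by
  induction b using WellFoundedGT.induction with | ind b ih =>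
  by_cases hbtop : b = ⊤
  · exact ⟨⊤, by rw [Ideal.map_top, hbtop]⟩
  obtain ⟨P, hPmax, hbP⟩ := Ideal.exists_le_maximal b hbtop
  have hP0 : P ≠ ⊥ := fun h => hb (le_bot_iff.1 (h ▸ hbP))
  have hle := le_map_under_of_smul_eq (G := G) hb hG hunr hP0 hbP
  set q := P.under A
  obtain ⟨c, hc⟩ := Ideal.dvd_iff_le.2 hle
  have hm0 : q.map (algebraMap A B) ≠ 0 := fun h => hb (by rw [hc, h, zero_mul]; rfl)
  have hc0 : c ≠ ⊥ := fun h => hb (by rw [hc, h, Ideal.mul_bot])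
  have hbc : b ≤ c := hc ▸ Ideal.mul_le_right
  obtain ⟨a, ha⟩ := ih c (lt_of_le_of_ne hbc fun h => by
      have : q.map (algebraMap A B) * c = 1 * c := by rw [← hc, h, one_mul]
      have := mul_right_cancel₀ hc0 this
      exact hPmax.ne_top (top_le_iff.1 (Ideal.one_eq_top.symm.le.trans
        (this.symm.le.trans Ideal.map_comap_le)))) hc0
    (fun g => by
      have := hG g
      rw [hc, smul_mul', Ideal.smul_map_algebraMap] at this
      exact mul_left_cancel₀ hm0 this)
    fun Q _ hQ0 hQ => hunr Q hQ0 (hbc.trans hQ)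
  exact ⟨q * a, by rw [Ideal.map_mul, ha, ← hc]⟩

end Descent

/-! ### Total positivity, and finiteness of `[α]_F` -/

section TotallyPositive

theorem IsTotallyPositive.map {F L : Type*} [Field F] [Field L] [Algebra F L] {β : 𝓞 F}
    (h : IsTotallyPositive β) : IsTotallyPositive (algebraMap (𝓞 F) (𝓞 L) β) :=
  fun φ => h (φ.comp (algebraMap F L))

theorem exists_real_embedding_eq {L : Type*} [Field L] [NumberField L]
    [IsTotallyReal L] (φ : L →+* ℂ) : ∃ ψ : L →+* ℝ, ∀ x, φ x = (ψ x : ℂ) :=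
  have h := IsTotallyReal.complexEmbedding_isReal φ
  ⟨h.embedding, fun x => (h.coe_embedding_apply x).symm⟩

/-- An extension to `ℂ` exists by algebraic closedness, and is real because `L` is totally real. -/
theorem exists_real_embedding_extension {F L : Type*} [Field F] [Field L] [NumberField L]
    [IsTotallyReal L] [Algebra F L] [Algebra.IsAlgebraic F L] (φ : F →+* ℝ) :
    ∃ ψ : L →+* ℝ, ∀ x, ψ (algebraMap F L x) = φ x := by
  let φ' : F →+* ℂ := Complex.ofRealHom.comp φ
  algebraize [φ']
  let ψ : L →ₐ[F] ℂ := IsAlgClosed.lift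
  obtain ⟨χ, hχ⟩ := exists_real_embedding_eq (ψ : L →+* ℂ)
  refine ⟨χ, fun x => ?_⟩
  have h1 := hχ (algebraMap F L x)
  have h2 : ψ (algebraMap F L x) = (φ x : ℂ) := ψ.commutes x
  exact Complex.ofReal_injective (h1.symm.trans h2)

theorem IsTotallyPositive.of_map {F L : Type*} [Field F] [Field L] [NumberField L]
    [IsTotallyReal L] [Algebra F L] [Algebra.IsAlgebraic F L] {β : 𝓞 F}
    (h : IsTotallyPositive (algebraMap (𝓞 F) (𝓞 L) β)) : IsTotallyPositive β := fun φ => by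
  obtain ⟨ψ, hψ⟩ := exists_real_embedding_extension (L := L) φ
  have := h ψ
  rwa [← hψ]

theorem IsTotallyPositive.ne_zero {F : Type*} [Field F] [NumberField F] [IsTotallyReal F]
    {β : 𝓞 F} (h : IsTotallyPositive β) : β ≠ 0 := by
  rintro rfl
  -- A real embedding must exist, as otherwise positivity is vacuous.
  obtain ⟨ψ, _⟩ := exists_real_embedding_eq (Classical.arbitrary (F →+* ℂ))
  simpa using h ψ

/-- The trace is a sum of positive conjugates, so it bounds each of them. -/
theorem IsTotallyPositive.norm_le_trace {F : Type*} [Field F] [NumberField F] [IsTotallyReal F]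
    {β : 𝓞 F} (h : IsTotallyPositive β) (φ : F →+* ℂ) :
    ‖φ (β : F)‖ ≤ (Algebra.trace ℚ F (β : F) : ℝ) := by
  have hpos : ∀ σ : F →+* ℂ, ∃ r : ℝ, 0 < r ∧ σ (β : F) = r := fun σ => by
    obtain ⟨ψ, hψ⟩ := exists_real_embedding_eq σ
    exact ⟨_, h ψ, hψ _⟩
  have htr := trace_eq_sum_embeddings (K := ℚ) (L := F) ℂ (x := (β : F))
  have hre := congrArg Complex.re htr
  rw [Complex.re_sum] at hre
  have hl : ((algebraMap ℚ ℂ) (Algebra.trace ℚ F (β : F))).re =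
      (Algebra.trace ℚ F (β : F) : ℝ) := by simp
  rw [← hl, hre]
  obtain ⟨r, hr, hφ⟩ := hpos φ
  have hn : ‖φ (β : F)‖ = (RingHom.toRatAlgHom φ (β : F)).re := by
    rw [RingHom.toRatAlgHom_apply, hφ]
    simp [abs_of_pos hr]
  rw [hn]
  refine Finset.single_le_sum (f := fun σ : F →ₐ[ℚ] ℂ => (σ (β : F)).re) (fun σ _ => ?_)
    (Finset.mem_univ _)
  obtain ⟨s, hs, hσ⟩ := hpos σ
  have : σ (β : F) = s := hσ
  simp [this, hs.le]

end TotallyPositive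

section TraceSet

variable {K : Type*} [Field K] [NumberField K] (S : Finset (HeightOneSpectrum (𝓞 K))) (α : 𝓞 K)

/-- The fixed trace bounds all conjugates of the integer `β`, leaving finitely many; each `β ≠ 0`
has finitely many ideal divisors. -/
theorem traceSet_finite (F : Type*) [Field F] [NumberField F] [IsTotallyReal F] [Algebra K F] :
    (traceSet S α F).Finite := by
  have h1 := Embeddings.finite_of_norm_le F ℂ
    ((Algebra.trace ℚ K ((Module.finrank K F : K) * (α : K)) : ℚ) : ℝ)
  set X := {x : F | IsIntegral ℤ x ∧ ∀ φ : F →+* ℂ, ‖φ x‖ ≤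
    ((Algebra.trace ℚ K ((Module.finrank K F : K) * (α : K)) : ℚ) : ℝ)}
  have h2 : {β : 𝓞 F | β ≠ 0 ∧ (β : F) ∈ X}.Finite :=
    (h1.preimage RingOfIntegers.coe_injective.injOn).subset fun β hβ => hβ.2
  have h3 : ∀ β : 𝓞 F, β ≠ 0 → {a : Ideal (𝓞 F) | β ∈ a}.Finite := fun β hβ => by
    have : Finite {a // a ∣ Ideal.span {β}} := (UniqueFactorizationMonoid.fintypeSubtypeDvd (Ideal.span {β}) (by simpa using hβ)).finite
    have hf : {a : Ideal (𝓞 F) | a ∣ Ideal.span {β}}.Finite := this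
    refine hf.subset fun a ha => ?_
    exact Ideal.dvd_span_singleton.2 ha
  refine (h2.biUnion (t := fun β => (Prod.mk β) '' {a : Ideal (𝓞 F) | β ∈ a})
    fun β hβ => (h3 β hβ.1).image _).subset ?_
  rintro ⟨β, a⟩ ⟨hpos, hmem, -, htr⟩
  simp only [Set.mem_iUnion]
  refine ⟨β, ⟨hpos.ne_zero, β.isIntegral_coe, fun φ => ?_⟩, a, hmem, rfl⟩
  rw [← htr, Algebra.trace_trace]
  exact hpos.norm_le_trace φ

end TraceSet

theorem IsPrimeTo.map_iff {K F L : Type*} [Field K] [Field F] [Field L] [Algebra K F] [Algebra K L]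
    [Algebra F L] [IsScalarTower K F L] [NumberField F] [NumberField L]
    {S : Finset (HeightOneSpectrum (𝓞 K))} {a : Ideal (𝓞 F)} :
    IsPrimeTo S (a.map (algebraMap (𝓞 F) (𝓞 L))) ↔ IsPrimeTo S a := by
  refine forall₂_congr fun v _ => ?_
  have : v.asIdeal.map (algebraMap (𝓞 K) (𝓞 L)) =
      (v.asIdeal.map (algebraMap (𝓞 K) (𝓞 F))).map (algebraMap (𝓞 F) (𝓞 L)) := by
    rw [Ideal.map_map, ← IsScalarTower.algebraMap_eq]
  rw [this, Ideal.isCoprime_iff_sup_eq, Ideal.isCoprime_iff_sup_eq, ← Ideal.map_sup]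
  refine ⟨fun h => ?_, fun h => by rw [h, Ideal.map_top]⟩
  rw [← Ideal.comap_map_eq_self_of_faithfullyFlat (B := 𝓞 L) (a ⊔ _), h, Ideal.comap_top]

theorem IsPrimeTo.not_liesOver {K F : Type*} [Field K] [Field F] [Algebra K F]
    {S : Finset (HeightOneSpectrum (𝓞 K))} {b : Ideal (𝓞 F)} (hb : IsPrimeTo S b)
    {P : Ideal (𝓞 F)} (hP : P ≠ ⊤) (hbP : b ≤ P) (v : HeightOneSpectrum (𝓞 K)) (hv : v ∈ S) :
    ¬ P.LiesOver v.asIdeal := fun h => by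
  have h1 := Ideal.isCoprime_iff_sup_eq.1 (hb v hv)
  refine hP (top_le_iff.1 (h1 ▸ sup_le hbP ?_))
  rw [Ideal.map_le_iff_le_comap, h.over]

theorem Algebra.trace_algebraMap_tower {K F L : Type*} [Field K] [Field F] [Field L] [Algebra K F]
    [Algebra K L] [Algebra F L] [IsScalarTower K F L] [FiniteDimensional K F]
    [FiniteDimensional F L] (x : F) :
    Algebra.trace K L (algebraMap F L x) = (Module.finrank F L : K) * Algebra.trace K F x := by
  rw [← Algebra.trace_trace (S := F), Algebra.trace_algebraMap, map_nsmul, nsmul_eq_mul]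

/-! ### Fixed points of `[α]_L` -/

section Fixed

variable {K L : Type*} [Field K] [Field L] [NumberField K] [NumberField L]
    [Algebra K L] [IsTotallyReal L]
    {S : Finset (HeightOneSpectrum (𝓞 K))} {α : 𝓞 K}

theorem mk_map_mem_traceSet_iff {F : Type*} [Field F] [NumberField F] [Algebra K F] [Algebra F L]
    [IsScalarTower K F L] {β : 𝓞 F} {a : Ideal (𝓞 F)} :
    (algebraMap (𝓞 F) (𝓞 L) β, a.map (algebraMap (𝓞 F) (𝓞 L))) ∈ traceSet S α L ↔
      (β, a) ∈ traceSet S α F := by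
  refine and_congr ⟨fun h => h.of_map, fun h => h.map⟩ (and_congr ?_ (and_congr ?_ ?_))
  · change β ∈ Ideal.comap (algebraMap (𝓞 F) (𝓞 L)) (a.map (algebraMap (𝓞 F) (𝓞 L))) ↔ _
    rw [Ideal.comap_map_eq_self_of_faithfullyFlat]
  · exact IsPrimeTo.map_iff
  · change Algebra.trace K L (algebraMap F L (β : F)) = _ ↔ _
    have : (Module.finrank F L : K) ≠ 0 := Nat.cast_ne_zero.2 Module.finrank_pos.ne'
    rw [Algebra.trace_algebraMap_tower, ← Module.finrank_mul_finrank K F L, Nat.cast_mul,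
      mul_comm (Module.finrank K F : K), mul_assoc, mul_right_inj' this]

theorem bijOn_traceSet [IsGalois K L] (hSram : IsUnramifiedOutside K K L S)
    (F : IntermediateField K L) :
    Set.BijOn
      (fun x : 𝓞 F × Ideal (𝓞 F) =>
        (algebraMap (𝓞 F) (𝓞 L) x.1, x.2.map (algebraMap (𝓞 F) (𝓞 L))))
      (traceSet S α F)
      {y ∈ traceSet S α L | ∀ σ ∈ F.fixingSubgroup, σ • y = y} := by
  refine ⟨fun x hx => ⟨mk_map_mem_traceSet_iff.2 hx, fun σ hσ => ?_⟩, fun x _ y _ h => ?_, ?_⟩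
  · obtain ⟨τ, rfl⟩ : ∃ τ : Gal(L/F), τ.restrictScalars K = σ :=
      ⟨F.fixingSubgroupEquiv ⟨σ, hσ⟩, rfl⟩
    refine Prod.ext ?_ ?_
    · change τ • algebraMap (𝓞 F) (𝓞 L) x.1 = _
      simp
    · exact Ideal.smul_map_algebraMap τ x.2
  · rw [Prod.mk.injEq] at h
    refine Prod.ext (FaithfulSMul.algebraMap_injective _ _ h.1) ?_
    rw [← Ideal.comap_map_eq_self_of_faithfullyFlat (B := 𝓞 L) x.2, h.2,
      Ideal.comap_map_eq_self_of_faithfullyFlat]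
  · rintro ⟨β, b⟩ ⟨hy, hfix⟩
    have hfix' : ∀ τ : Gal(L/F), τ • β = β ∧ τ • b = b := fun τ =>
      Prod.mk.inj (hfix (τ.restrictScalars K) (F.fixingSubgroupEquiv.symm τ).2)
    obtain ⟨β', rfl⟩ : ∃ β' : 𝓞 F, algebraMap (𝓞 F) (𝓞 L) β' = β :=
      Algebra.IsInvariant.isInvariant (G := Gal(L/F)) β fun τ => (hfix' τ).1
    have hb : b ≠ ⊥ := by
      rintro rfl
      exact hy.1.ne_zero (by simpa using hy.2.1)
    -- Primes containing `b` avoid `S`, hence are unramified over `K` and so over `F`.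
    obtain ⟨a, rfl⟩ := Ideal.exists_map_eq_of_smul_eq (A := 𝓞 F) (G := Gal(L/F)) hb
      (fun τ => (hfix' τ).2) fun P hP hP0 hbP => by
        have := hSram ⟨P, hP, hP0⟩ (hy.2.2.1.not_liesOver hP.ne_top hbP)
        exact Algebra.IsUnramifiedAt.of_restrictScalars (𝓞 K) P
    exact ⟨(β', a), mk_map_mem_traceSet_iff.1 hy, rfl⟩

end Fixed

/-! ### Uniqueness of Frobenius and equivariance of the Artin symbol -/

section Frobenius

variable {K L : Type*} [Field K] [Field L] [Algebra K L] {S : Finset (HeightOneSpectrum (𝓞 K))}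

theorem maxAbelian_hom_ext {g g' : HS K L S}
    (h : ∀ E (hE : E ∈ finiteAbelianUnramified K L S) (y : E),
      g ⟨y, le_sSup hE y.2⟩ = g' ⟨y, le_sSup hE y.2⟩) : g = g' := by
  let c : HS K L S := g⁻¹ * g'
  let T : IntermediateField L (maxAbelian K L S) :=
    IntermediateField.fixedField (Subgroup.zpowers c)
  have key : maxAbelian K L S ≤ IntermediateField.lift T := by
    refine sSup_le fun E hE y hy => ?_
    have hEM : E ≤ maxAbelian K L S := le_sSup hE
    rw [IntermediateField.mem_lift ⟨y, hEM hy⟩]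
    have h2 : c ⟨y, hEM hy⟩ = ⟨y, hEM hy⟩ := by
      change g⁻¹ (g' _) = _
      rw [← h E hE ⟨y, hy⟩]
      exact g.symm_apply_apply _
    rintro ⟨f, hf⟩
    have hle : Subgroup.zpowers c ≤
        MulAction.stabilizer (HS K L S) (⟨y, hEM hy⟩ : maxAbelian K L S) := by
      rw [Subgroup.zpowers_le]
      exact h2
    exact hle hf
  have hc : c = 1 := by
    ext x : 1
    have hx : x ∈ T := (IntermediateField.mem_lift x).1 (key x.2)
    exact hx ⟨_, Subgroup.mem_zpowers _⟩
  exact (inv_mul_eq_one.1 hc)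

theorem IsArithFrobAt.restrictNormal {L E M : Type*} [Field L] [Field E] [Field M] [Algebra L E]
    [Algebra L M] [Algebra E M] [IsScalarTower L E M] [Normal L E] {g : Gal(M/L)}
    {Q : Ideal (𝓞 M)} (h : AlgHom.IsArithFrobAt (RingOfIntegers.mapAlgHom (k := L) g) Q) :
    AlgHom.IsArithFrobAt (RingOfIntegers.mapAlgHom (k := L) (g.restrictNormal E))
      (Q.under (𝓞 E)) := by
  intro x
  have hx := h (algebraMap (𝓞 E) (𝓞 M) x)
  rw [Ideal.under_under]
  change algebraMap (𝓞 E) (𝓞 M) _ ∈ Q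
  rw [map_sub, map_pow]
  convert hx using 2
  ext
  exact AlgEquiv.restrictNormal_commutes g E (x : E)

/-- It suffices to compare restrictions to the finite layers `E`; these are unramified at `q`, where
a Frobenius is determined by its congruence. -/
theorem IsFrobeniusAt.unique [NumberField L] {q : Ideal (𝓞 L)} [q.IsPrime] (hq : q ≠ ⊥)
    (hqS : ∀ v ∈ S, ¬ q.LiesOver v.asIdeal) {g g' : HS K L S} (hg : IsFrobeniusAt K L S q g)
    (hg' : IsFrobeniusAt K L S q g') : g = g' := by
  refine maxAbelian_hom_ext fun E hE y => ?_
  have hEM : E ≤ maxAbelian K L S := le_sSup hE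
  obtain ⟨hfin, hab, hunr⟩ := hE
  have : NumberField E := NumberField.of_module_finite L E
  let i : E →ₐ[L] maxAbelian K L S := IntermediateField.inclusion hEM
  let : Algebra E (maxAbelian K L S) := i.toRingHom.toAlgebra
  have : IsScalarTower L E (maxAbelian K L S) := .of_algebraMap_eq fun x => (i.commutes x).symm
  have : Algebra.IsIntegral (𝓞 E) (𝓞 (maxAbelian K L S)) := Algebra.IsIntegral.tower_top ℤ
  obtain ⟨P, hP, hPq⟩ := (inferInstance : Nonempty (q.primesOver (𝓞 E)))
  obtain ⟨Q, hQ, hQP⟩ := (inferInstance : Nonempty (P.primesOver (𝓞 (maxAbelian K L S))))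
  have hQq : Q.LiesOver q := .trans Q P q
  have h1 := IsArithFrobAt.restrictNormal (E := E) (hg Q hQ hQq)
  have h2 := IsArithFrobAt.restrictNormal (E := E) (hg' Q hQ hQq)
  rw [← hQP.over] at h1 h2
  have hP0 : P ≠ ⊥ := Ideal.ne_bot_of_liesOver_of_ne_bot hq P
  have hPunr : Algebra.IsUnramifiedAt (𝓞 L) P := hunr ⟨P, hP, hP0⟩ fun v hv hPv =>
    hqS v hv ⟨by rw [hPv.over, hPq.over, Ideal.under_under]⟩
  have h3 := h1.eq_of_isUnramifiedAt h2 (Ideal.primeCompl_le_nonZeroDivisors P)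
  have h4 : (g : maxAbelian K L S →+* maxAbelian K L S).comp i.toRingHom =
      (g' : maxAbelian K L S →+* maxAbelian K L S).comp i.toRingHom := by
    refine IsLocalization.ringHom_ext (nonZeroDivisors (𝓞 E)) (RingHom.ext fun x => ?_)
    have h5 := congrArg (fun z : 𝓞 E => algebraMap E (maxAbelian K L S) z) (DFunLike.congr_fun h3 x)
    exact (AlgEquiv.restrictNormal_commutes g E (x : E)).symm.trans
      (h5.trans (AlgEquiv.restrictNormal_commutes g' E (x : E)))
  exact DFunLike.congr_fun h4 y

end Frobenius

section Conj

variable {K L : Type*} [Field K] [Field L] [Algebra K L] [Normal K L]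
  {S : Finset (HeightOneSpectrum (𝓞 K))}

theorem conjGal_one {M : Type*} [Field M] [Algebra K M]
    [Algebra L M] [IsScalarTower K L M] (s : Gal(M/K)) : conjGal s (1 : Gal(M/L)) = 1 := by
  ext x
  exact s.apply_symm_apply x

theorem conjGal_mul {M : Type*} [Field M] [Algebra K M]
    [Algebra L M] [IsScalarTower K L M] (s : Gal(M/K)) (g h : Gal(M/L)) :
    conjGal s (g * h) = conjGal s g * conjGal s h := by
  ext x
  change s (g (h (s⁻¹ x))) = s (g (s⁻¹ (s (h (s⁻¹ x)))))
  rw [show ∀ y, s⁻¹ (s y) = y from s.symm_apply_apply]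

theorem IsFrobeniusAt.conjGal {q : Ideal (𝓞 L)} {g : HS K L S} (h : IsFrobeniusAt K L S q g)
    (s : Gal(maxAbelian K L S/K)) :
    IsFrobeniusAt K L S (AlgEquiv.restrictNormalHom L s • q) (conjGal s g) := by
  intro Q hQ hQq x
  set σ := AlgEquiv.restrictNormalHom L s
  have hσ : ∀ y : 𝓞 L, s • algebraMap (𝓞 L) (𝓞 (maxAbelian K L S)) y =
      algebraMap (𝓞 L) (𝓞 (maxAbelian K L S)) (σ • y) := fun y => by
    ext
    exact congrArg _ (AlgEquiv.restrictNormal_commutes s L (y : L)).symm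
  have hprime : (s⁻¹ • Q).IsPrime := inferInstance
  have hover : (s⁻¹ • Q).LiesOver q := ⟨by
    ext y
    rw [← Ideal.smul_mem_pointwise_smul_iff (a := σ), hQq.over]
    change algebraMap (𝓞 L) (𝓞 (maxAbelian K L S)) (σ • y) ∈ Q ↔ algebraMap _ _ y ∈ s⁻¹ • Q
    rw [← hσ, Ideal.mem_inv_pointwise_smul_iff]⟩
  have hx := h _ hprime hover (s⁻¹ • x)
  rw [← hover.over, Ideal.mem_inv_pointwise_smul_iff, smul_sub, smul_pow', smul_inv_smul] at hx
  rw [← hQq.over]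
  have hcard : Nat.card (𝓞 L ⧸ σ • q) = Nat.card (𝓞 L ⧸ q) :=
    Nat.card_congr (Ideal.quotientEquiv q (σ • q)
      (MulSemiringAction.toRingEquiv Gal(L/K) (𝓞 L) σ) rfl).symm.toEquiv
  rw [hcard]
  exact hx

/-- Conjugation carries Frobenius elements at `q` to those at `σ • q`, and uniqueness matches the
choices. If none exists at `q`, none exists at `σ • q`, and the default value 1 is fixed by
conjugation. -/
theorem frobeniusAt_smul [NumberField L] {q : Ideal (𝓞 L)} [q.IsPrime] (hq : q ≠ ⊥)
    (hqS : ∀ v ∈ S, ¬ q.LiesOver v.asIdeal) (s : Gal(maxAbelian K L S/K)) :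
    frobeniusAt K L S (AlgEquiv.restrictNormalHom L s • q) =
      conjGal s (frobeniusAt K L S q) := by
  set σ := AlgEquiv.restrictNormalHom L s with hσ
  by_cases h : ∃ g, IsFrobeniusAt K L S q g
  · have h' : ∃ g, IsFrobeniusAt K L S (σ • q) g := ⟨_, h.choose_spec.conjGal s⟩
    have h1 : IsFrobeniusAt K L S q (frobeniusAt K L S q) := by
      rw [frobeniusAt, dif_pos h]
      exact h.choose_spec
    have h2 : IsFrobeniusAt K L S (σ • q) (frobeniusAt K L S (σ • q)) := by
      rw [frobeniusAt, dif_pos h']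
      exact h'.choose_spec
    refine IsFrobeniusAt.unique (q := σ • q) (fun h0 => hq ?_) (fun v hv hlies => hqS v hv ⟨?_⟩)
      h2 (h1.conjGal s)
    · rw [← inv_smul_smul σ q, h0, Ideal.smul_bot]
    · rw [hlies.over]
      ext x
      change algebraMap (𝓞 K) (𝓞 L) x ∈ σ • q ↔ algebraMap (𝓞 K) (𝓞 L) x ∈ q
      rw [Ideal.mem_pointwise_smul_iff_inv_smul_mem]
      congr! 1
      ext
      exact (σ⁻¹).commutes (x : K)
  · have h' : ¬ ∃ g, IsFrobeniusAt K L S (σ • q) g := by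
      rintro ⟨g, hg⟩
      have := hg.conjGal s⁻¹
      rw [map_inv, ← hσ, inv_smul_smul] at this
      exact h ⟨_, this⟩
    rw [frobeniusAt, dif_neg h', frobeniusAt, dif_neg h, conjGal_one]

open UniqueFactorizationMonoid in
theorem Ideal.normalizedFactors_smul {G A : Type*} [Group G] [CommRing A] [IsDedekindDomain A]
    [MulSemiringAction G A] (g : G) {b : Ideal A} (hb : b ≠ ⊥) :
    normalizedFactors (g • b) = (normalizedFactors b).map (g • ·) := by
  have h1 : ((normalizedFactors b).map (g • ·)).prod = g • b := by
    conv_rhs => rw [← prod_normalizedFactors_eq_self hb]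
    exact (map_multiset_prod (MulDistribMulAction.toMonoidHom (Ideal A) g) _).symm
  rw [← h1]
  refine normalizedFactors_prod_of_prime fun P hP => ?_
  obtain ⟨Q, hQ, rfl⟩ := Multiset.mem_map.1 hP
  have hQ' := prime_of_normalized_factor Q hQ
  have := Ideal.isPrime_of_prime hQ'
  refine Ideal.prime_of_isPrime (fun h0 => hQ'.ne_zero ?_) inferInstance
  rw [← inv_smul_smul g Q, h0, Ideal.smul_bot]
  rfl

open UniqueFactorizationMonoid in
theorem artinSymbol_smul [NumberField L] {b : Ideal (𝓞 L)} (hb : b ≠ ⊥) (hbS : IsPrimeTo S b)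
    (s : Gal(maxAbelian K L S/K)) :
    artinSymbol K L S (AlgEquiv.restrictNormalHom L s • b) =
      conjGal s (artinSymbol K L S b) := by
  let c : HS K L S →* HS K L S := ⟨⟨conjGal s, conjGal_one s⟩, conjGal_mul s⟩
  change _ = c _
  rw [artinSymbol, artinSymbol, Ideal.normalizedFactors_smul _ hb, Multiset.map_map,
    map_multiset_prod, Multiset.map_map]
  congr 1
  refine Multiset.map_congr rfl fun q hq => ?_
  have hq' := prime_of_normalized_factor q hq
  have := Ideal.isPrime_of_prime hq'
  exact frobeniusAt_smul hq'.ne_zero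
    (hbS.not_liesOver this.ne_top (Ideal.le_of_dvd (dvd_of_mem_normalizedFactors hq))) s

end Conj

/-! ### Norms and the Möbius sum over `[α]_L` -/

theorem isUnit_natCast_zLoc {p : ℕ} [Fact p.Prime] {n : ℕ} (h : ¬ p ∣ n) :
    IsUnit (n : ZLoc p) := by
  have := IsLocalization.map_units (ZLoc p) (⟨(n : ℤ), fun h' => h
    (Int.natCast_dvd_natCast.1 (Ideal.mem_span_singleton.1 h'))⟩ :
      (Ideal.span {(p : ℤ)}).primeCompl)
  simpa using this

theorem sum_subgroupMobius_mul_pow_congr {T T' R : Type*} [Group T] [Finite T] [Group T']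
    [Finite T'] [Fintype (Subgroup T)] [Fintype (Subgroup T')] [CommRing R] (e : T ≃* T') (r : R) :
    ∑ H : Subgroup T, (subgroupMobius T H : R) * r ^ H.index =
      ∑ H : Subgroup T', (subgroupMobius T' H : R) * r ^ H.index := by
  refine Fintype.sum_equiv e.mapSubgroup.toEquiv _ _ fun H => ?_
  have h1 := subgroupMobius_map (e : T →* T') e.injective H
  have h2 := Subgroup.index_map_equiv H e
  change _ = (subgroupMobius T' (H.map (e : T →* T')) : R) * r ^ (H.map (e : T →* T')).index
  rw [h1, h2]

theorem Ideal.absNorm_smul {G A : Type*} [Group G] [CommRing A] [IsDedekindDomain A]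
    [Module.Free ℤ A] [MulSemiringAction G A] (g : G) (b : Ideal A) :
    Ideal.absNorm (g • b) = Ideal.absNorm b :=
  Nat.card_congr (Ideal.quotientEquiv b (g • b)
      (MulSemiringAction.toRingEquiv G A g) rfl).symm.toEquiv

section Galois

variable {K L : Type*} [Field K] [Field L] [NumberField K] [NumberField L]
  [Algebra K L] {S : Finset (HeightOneSpectrum (𝓞 K))} {α : 𝓞 K}

theorem IsPrimeTo.smul [IsGalois K L] {b : Ideal (𝓞 L)} (h : IsPrimeTo S b) (σ : Gal(L/K)) :
    IsPrimeTo S (σ • b) := fun v hv => by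
  have := Ideal.isCoprime_iff_sup_eq.1 (h v hv)
  rw [Ideal.isCoprime_iff_sup_eq, ← Ideal.smul_map_algebraMap σ (v.asIdeal),
    Ideal.pointwise_smul_def, Ideal.pointwise_smul_def, ← Ideal.map_sup, this, Ideal.map_top]

theorem smul_mem_traceSet [IsGalois K L] {y : 𝓞 L × Ideal (𝓞 L)} (hy : y ∈ traceSet S α L) (σ : Gal(L/K)) :
    σ • y ∈ traceSet S α L :=
  ⟨fun φ => hy.1 (φ.comp (σ : L →+* L)), Ideal.smul_mem_pointwise_smul _ _ _ hy.2.1,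
    hy.2.2.1.smul σ, (Algebra.trace_eq_of_algEquiv σ (y.1 : L)).trans hy.2.2.2⟩

theorem IsPrimeTo.not_dvd_absNorm {p : ℕ} (hp : p.Prime)
    (hSp : ∀ v : HeightOneSpectrum (𝓞 K), (p : 𝓞 K) ∈ v.asIdeal → v ∈ S)
    {b : Ideal (𝓞 L)} (hb : IsPrimeTo S b) : ¬ p ∣ Ideal.absNorm b := fun h => by
  obtain ⟨P, hP, hPp, hPb⟩ := Ideal.exists_isMaximal_dvd_of_dvd_absNorm' hp b h
  have hmem : (p : 𝓞 L) ∈ P := by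
    have : (p : ℤ) ∈ P.under ℤ := by rw [hPp]; exact Ideal.mem_span_singleton_self _
    simpa [Ideal.mem_comap] using this
  have hmem' : (p : 𝓞 K) ∈ P.under (𝓞 K) := by simpa [Ideal.mem_comap] using hmem
  refine hb.not_liesOver hP.ne_top (Ideal.le_of_dvd hPb)
    ⟨P.under (𝓞 K), inferInstance, fun h0 => ?_⟩ (hSp _ hmem') ⟨rfl⟩
  rw [h0, Ideal.mem_bot] at hmem'
  exact hp.ne_zero (Nat.cast_eq_zero.1 hmem')

variable [IsGalois K L] [IsTotallyReal L]

theorem absNorm_under_pow (hSram : IsUnramifiedOutside K K L S) (F : IntermediateField K L)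
    {y : 𝓞 L × Ideal (𝓞 L)} (hy : y ∈ traceSet S α L)
    (hF : F.fixingSubgroup ≤ MulAction.stabilizer Gal(L/K) y) :
    Ideal.absNorm (y.2.under (𝓞 F)) ^ Nat.card F.fixingSubgroup = Ideal.absNorm y.2 := by
  obtain ⟨x, -, rfl⟩ := (bijOn_traceSet hSram F).surjOn ⟨hy, fun σ hσ => hF hσ⟩
  change Ideal.absNorm (Ideal.comap _ (x.2.map _)) ^ _ = Ideal.absNorm (x.2.map _)
  rw [Ideal.comap_map_eq_self_of_faithfullyFlat, Ideal.absNorm_algebraMap,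
    IsGalois.card_fixingSubgroup_eq_finrank, IsFractionRing.finrank_eq (𝓞 F) F (𝓞 L) L]

/-- With `H = Σ_F`, the norm from `F` is `n ^ [T : H]`, and `[T : H] (|H| k - 1) = |T| k - [T : H]`.
This separates the factor `N(b) ^ k` from a power of `n⁻¹`. -/
theorem sum_subgroupMobius_mul_absNorm_under {p : ℕ} [Fact p.Prime]
    [Fintype (IntermediateField K L)] (hSram : IsUnramifiedOutside K K L S)
    {k : ℕ} (hk : 0 < k) {y : 𝓞 L × Ideal (𝓞 L)} (hy : y ∈ traceSet S α L)
    {T : Subgroup Gal(L/K)} (hT : T ≤ MulAction.stabilizer Gal(L/K) y)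
    [DecidablePred fun F : IntermediateField K L => F.fixingSubgroup ≤ T] [Fintype (Subgroup T)]
    {n : ℕ} (hn : n ^ Nat.card T = Ideal.absNorm y.2) {u : (ZLoc p)ˣ} (hu : (u : ZLoc p) = n) :
    ∑ F : IntermediateField K L with F.fixingSubgroup ≤ T,
      (subgroupMobius Gal(L/K) F.fixingSubgroup : ZLoc p) *
        (Ideal.absNorm (y.2.under (𝓞 F)) : ZLoc p) ^ (Module.finrank F L * k - 1) =
    (Ideal.absNorm y.2 : ZLoc p) ^ k *
      ∑ H : Subgroup T, (subgroupMobius T H : ZLoc p) *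
        ((u⁻¹ : (ZLoc p)ˣ) : ZLoc p) ^ H.index := by
  rw [Finset.mul_sum]
  refine Finset.sum_bij' (fun F _ => F.fixingSubgroup.subgroupOf T)
    (fun H _ => IntermediateField.fixedField (H.map T.subtype)) (fun _ _ => Finset.mem_univ _)
    (fun H _ => ?_) (fun F hF => ?_) (fun H _ => ?_) (fun F hF => ?_)
  · rw [Finset.mem_filter, IntermediateField.fixingSubgroup_fixedField]
    exact ⟨Finset.mem_univ _, Subgroup.map_subtype_le H⟩
  · rw [Subgroup.map_subgroupOf_eq_of_le (Finset.mem_filter.1 hF).2,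
      IsGalois.fixedField_fixingSubgroup]
  · rw [IntermediateField.fixingSubgroup_fixedField, Subgroup.subgroupOf,
      Subgroup.comap_map_eq_self_of_injective T.subtype_injective]
  · have hFT := (Finset.mem_filter.1 hF).2
    have hmap := Subgroup.map_subgroupOf_eq_of_le hFT
    set H := F.fixingSubgroup.subgroupOf T
    have hmu : subgroupMobius Gal(L/K) F.fixingSubgroup = subgroupMobius T H := by
      rw [← hmap, subgroupMobius_map _ T.subtype_injective]
    have hcard : Nat.card F.fixingSubgroup = Nat.card H := by
      rw [← hmap, Subgroup.card_map_of_injective T.subtype_injective]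
    have hidx := H.index_mul_card
    have hpos : 0 < Nat.card H := Nat.card_pos
    have hnorm : Ideal.absNorm (y.2.under (𝓞 F)) = n ^ H.index := by
      refine Nat.pow_left_injective hpos.ne' ?_
      change _ ^ _ = (_ ^ _) ^ _
      rw [← pow_mul, hidx, hn, ← hcard]
      exact absNorm_under_pow hSram F hy (hFT.trans hT)
    -- The truncated subtraction is exact since `|H| k > 0`.
    have hexp : H.index * (Nat.card H * k - 1) + H.index = Nat.card T * k := by
      have : 0 < Nat.card H * k := Nat.mul_pos hpos hk
      rw [← Nat.mul_succ, Nat.succ_eq_add_one, Nat.sub_add_cancel this, ← mul_assoc, hidx]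
    have hval : ((u : ZLoc p) ^ H.index) ^ (Nat.card H * k - 1) =
        ((u : ZLoc p) ^ Nat.card T) ^ k * ((u⁻¹ : (ZLoc p)ˣ) : ZLoc p) ^ H.index := by
      rw [← pow_mul, ← pow_mul, ← hexp, pow_add, mul_assoc, ← mul_pow, Units.mul_inv, one_pow,
        mul_one]
    rw [hmu, hnorm, ← IsGalois.card_fixingSubgroup_eq_finrank, hcard, ← hn, Nat.cast_pow,
      Nat.cast_pow, ← hu, hval]
    ring

theorem natCard_stabilizerFun_dvd_sum {p : ℕ} [Fact p.Prime]
    (hdeg : ∃ n : ℕ, Module.finrank K L = p ^ n)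
    (hSp : ∀ v : HeightOneSpectrum (𝓞 K), (p : 𝓞 K) ∈ v.asIdeal → v ∈ S)
    (hSram : IsUnramifiedOutside K K L S) {k : ℕ} (hk : 0 < k) (ε : HS K L S → ZLoc p) :
    (Nat.card (stabilizerFun ε) : ZLoc p) ∣
      ∑ᶠ F : IntermediateField K L, (subgroupMobius Gal(L/K) F.fixingSubgroup : ZLoc p) *
        ∑ᶠ x ∈ traceSet S α F,
          ε (artinSymbol K L S (x.2.map (algebraMap (𝓞 F) (𝓞 L)))) *
            (Ideal.absNorm x.2 : ZLoc p) ^ (Module.finrank F L * k - 1) := by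
  classical
  have hfinF : Finite (IntermediateField K L) :=
    .of_equiv _ (IsGalois.intermediateFieldEquivSubgroup (F := K) (E := L)).symm.toEquiv
  have := Fintype.ofFinite (IntermediateField K L)
  have hfin := traceSet_finite S α L
  let X : SubMulAction Gal(L/K) (𝓞 L × Ideal (𝓞 L)) :=
    ⟨traceSet S α L, fun σ _ hy => smul_mem_traceSet hy σ⟩
  have : Finite X := hfin
  have := Fintype.ofFinite X
  let st (y : 𝓞 L × Ideal (𝓞 L)) := MulAction.stabilizer Gal(L/K) y
  let (y : 𝓞 L × Ideal (𝓞 L)) : Fintype (Subgroup (st y)) := Fintype.ofFinite _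
  let w (y : 𝓞 L × Ideal (𝓞 L)) : ZLoc p :=
    ∑ F : IntermediateField K L with F.fixingSubgroup ≤ st y,
      (subgroupMobius Gal(L/K) F.fixingSubgroup : ZLoc p) *
        (Ideal.absNorm (y.2.under (𝓞 F)) : ZLoc p) ^ (Module.finrank F L * k - 1)
  have hsum : (∑ᶠ F : IntermediateField K L,
        (subgroupMobius Gal(L/K) F.fixingSubgroup : ZLoc p) *
        ∑ᶠ x ∈ traceSet S α F,
          ε (artinSymbol K L S (x.2.map (algebraMap (𝓞 F) (𝓞 L)))) *
            (Ideal.absNorm x.2 : ZLoc p) ^ (Module.finrank F L * k - 1)) =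
      ∑ y : X, ε (artinSymbol K L S y.1.2) * w y.1 := by
    have h1 (F : IntermediateField K L) : (∑ᶠ x ∈ traceSet S α F,
          ε (artinSymbol K L S (x.2.map (algebraMap (𝓞 F) (𝓞 L)))) *
            (Ideal.absNorm x.2 : ZLoc p) ^ (Module.finrank F L * k - 1)) =
        ∑ y : X, if F.fixingSubgroup ≤ st y.1 then ε (artinSymbol K L S y.1.2) *
          (Ideal.absNorm (y.1.2.under (𝓞 F)) : ZLoc p) ^ (Module.finrank F L * k - 1) else 0 := by
      rw [finsum_mem_eq_of_bijOn (g := fun y => ε (artinSymbol K L S y.2) *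
          (Ideal.absNorm (y.2.under (𝓞 F)) : ZLoc p) ^ (Module.finrank F L * k - 1)) _
          (bijOn_traceSet (α := α) hSram F),
        finsum_mem_eq_finite_toFinset_sum _ (hfin.subset (Set.sep_subset _ _)),
        ← Finset.sum_filter]
      · refine (Finset.sum_bij (fun (y : X) _ => y.1) (fun y hy => ?_) (fun y _ z _ h =>
          Subtype.ext h) (fun y hy => ?_) (fun y _ => rfl)).symm
        · rw [Set.Finite.mem_toFinset]
          exact ⟨y.2, fun σ hσ => (Finset.mem_filter.1 hy).2 hσ⟩
        · rw [Set.Finite.mem_toFinset] at hy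
          exact ⟨⟨y, hy.1⟩, Finset.mem_filter.2 ⟨Finset.mem_univ _, fun σ hσ => hy.2 σ hσ⟩, rfl⟩
      · intro x _
        change _ = _ * (Ideal.absNorm (Ideal.comap _ (x.2.map _)) : ZLoc p) ^ _
        rw [Ideal.comap_map_eq_self_of_faithfullyFlat]
    rw [finsum_eq_sum_of_fintype]
    simp only [h1, Finset.mul_sum, w]
    rw [Finset.sum_comm]
    refine Finset.sum_congr rfl fun y _ => ?_
    rw [Finset.sum_filter]
    refine Finset.sum_congr rfl fun F _ => ?_
    split_ifs
    · ring
    · simp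
  -- The root is the norm of the contraction of `b` to the fixed field of the stabilizer of `y`.
  have hroot (y : X) : ∃ n : ℕ, n ^ Nat.card (st y.1) = Ideal.absNorm y.1.2 := by
    have h := absNorm_under_pow hSram (IntermediateField.fixedField (st y.1)) y.2
    rw [IntermediateField.fixingSubgroup_fixedField] at h
    exact ⟨_, h le_rfl⟩
  have hunit (y : X) {n : ℕ} (hn : n ^ Nat.card (st y.1) = Ideal.absNorm y.1.2) :
      IsUnit (n : ZLoc p) := isUnit_natCast_zLoc fun h =>
    y.2.2.2.1.not_dvd_absNorm Fact.out hSp (hn ▸ h.trans (dvd_pow_self n Nat.card_pos.ne'))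
  have hG : IsPGroup p Gal(L/K) := by
    obtain ⟨n, hn⟩ := hdeg
    exact IsPGroup.of_card (n := n) (by rw [IsGalois.card_aut_eq_finrank, hn])
  rw [hsum]
  refine natCard_dvd_sum_of_stabilizer (A := stabilizerFun ε) _ (fun a y => ?_) fun y => ?_
  · obtain ⟨a, s, hs, rfl⟩ := a
    set σ := AlgEquiv.restrictNormalHom L s with hσ
    change ε (artinSymbol K L S (σ • y.1.2)) * w (σ • y.1) = _
    have hb : y.1.2 ≠ ⊥ := fun h0 => y.2.1.ne_zero (by have := y.2.2.1; rwa [h0] at this)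
    rw [hσ, artinSymbol_smul hb y.2.2.2.1 s, hs, ← hσ]
    congr 1
    -- The same root serves `y` and `σ • y`, whose norms agree and whose stabilizers are isomorphic,
    -- so the closed forms of `w` coincide.
    obtain ⟨n, hn⟩ := hroot y
    obtain ⟨u, hu⟩ := hunit y hn
    let e : st y.1 ≃* st (σ • y.1) := MulAction.stabilizerEquivStabilizer rfl
    have hnorm : Ideal.absNorm (σ • y.1).2 = Ideal.absNorm y.1.2 := Ideal.absNorm_smul σ y.1.2
    have hn' : n ^ Nat.card (st (σ • y.1)) = Ideal.absNorm (σ • y.1).2 := by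
      rw [hnorm, ← hn, Nat.card_congr e.toEquiv]
    simp only [w]
    rw [sum_subgroupMobius_mul_absNorm_under hSram hk y.2 (T := st y.1) le_rfl hn hu,
      sum_subgroupMobius_mul_absNorm_under hSram hk (smul_mem_traceSet y.2 σ)
        (T := st (σ • y.1)) le_rfl hn' hu, hnorm,
      sum_subgroupMobius_mul_pow_congr e]
  · refine Dvd.dvd.mul_left ?_ _
    obtain ⟨n, hn⟩ := hroot y
    obtain ⟨u, hu⟩ := hunit y hn
    simp only [w]
    rw [sum_subgroupMobius_mul_absNorm_under hSram hk y.2 (T := st y.1) le_rfl hn hu]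
    refine Dvd.dvd.mul_left (dvd_trans ?_ (natCard_dvd_sum_subgroupMobius_mul_pow_zLoc _
      (hG.to_subgroup (st y.1)) _)) _
    -- The stabilizer inside `stabilizerFun ε` embeds in the full stabilizer, so its order divides
    -- `|T|`.
    let i : MulAction.stabilizer (stabilizerFun ε) y →* st y.1 :=
      ((stabilizerFun ε).subtype.comp (MulAction.stabilizer (stabilizerFun ε) y).subtype).codRestrict
        (st y.1) fun a => congrArg Subtype.val a.2
    refine Nat.cast_dvd_cast (Subgroup.card_dvd_of_injective i fun a b h => ?_)
    exact Subtype.ext (Subtype.ext (congrArg (fun z : st y.1 => z.1) h))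

end Galois

theorem proposition9 {K L : Type*} [Field K] [Field L] [NumberField K] [NumberField L]
    [Algebra K L] [IsGalois K L] [IsTotallyReal K] [IsTotallyReal L]
    (p : ℕ) [Fact p.Prime] (hdeg : ∃ n : ℕ, Module.finrank K L = p ^ n)
    (S : Finset (HeightOneSpectrum (𝓞 K)))
    (hSp : ∀ v : HeightOneSpectrum (𝓞 K), (p : 𝓞 K) ∈ v.asIdeal → v ∈ S)
    (hSram : IsUnramifiedOutside K K L S)
    (α : 𝓞 K) (hα : IsTotallyPositive α) :
    -- The set `[α]_F` is finite and is identified with the fixed points in `[α]_L` of `Gal(L/F)`.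
    (∀ F : IntermediateField K L,
      (traceSet S α F).Finite ∧
      Set.BijOn
        (fun x : 𝓞 F × Ideal (𝓞 F) =>
          (algebraMap (𝓞 F) (𝓞 L) x.1, x.2.map (algebraMap (𝓞 F) (𝓞 L))))
        (traceSet S α F)
        {y ∈ traceSet S α L | ∀ σ ∈ F.fixingSubgroup, σ • y = y}) ∧
    -- The congruence for the Möbius sum.
    (∀ (k : ℕ), 0 < k → Even k →
      ∀ ε : HS K L S → ZLoc p, IsLocallyConstant ε → IsEvenFunction ε →
      (Nat.card (stabilizerFun ε) : ZLoc p) ∣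
        ∑ᶠ F : IntermediateField K L, (subgroupMobius Gal(L/K) F.fixingSubgroup : ZLoc p) *
          ∑ᶠ x ∈ traceSet S α F,
            ε (artinSymbol K L S (x.2.map (algebraMap (𝓞 F) (𝓞 L)))) *
              (Ideal.absNorm x.2 : ZLoc p) ^ (Module.finrank F L * k - 1)) ∧
    -- The congruence for finite `p`-groups.
    (∀ (P : Type*) [Group P] [Finite P], IsPGroup p P → ∀ r : (ZLoc p)ˣ,
      (Nat.card P : ZLoc p) ∣
        ∑ᶠ P' : Subgroup P, (subgroupMobius P P' : ZLoc p) * (r : ZLoc p) ^ P'.index) := by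
  refine ⟨fun F => ?_, fun k hk _ ε _ _ => natCard_stabilizerFun_dvd_sum hdeg hSp hSram hk ε,
    fun P _ _ hP r => ?_⟩
  · have := IsTotallyReal.of_algebra F L
    exact ⟨traceSet_finite S α F, bijOn_traceSet hSram F⟩
  · have := Fintype.ofFinite (Subgroup P)
    rw [finsum_eq_sum_of_fintype]
    exact natCard_dvd_sum_subgroupMobius_mul_pow_zLoc P hP r
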